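/- Let $p$ be an odd prime. For a finite group $G$ and an element $F=\sum_{g\in G}a_g\,g$ of the group ring $\mathbb Z[G]$, let $$M_G(F)=\det\left(a_{gh^{-1}}\right)_{g,h\in G}$$ be its integer group determinant. Let $H_p$ be the Heisenberg group of order $p^3$, that is, the group under multiplication of the matrices $\begin{pmatrix}1&a&c\\0&1&b\\0&0&1\end{pmatrix}$ with $a,b,c\in\mathbb Z_p=\mathbb Z/p\mathbb Z$. Let $x,y,z\in H_p$ be the matrices with $(a,b,c)=(0,1,0)$, $(1,0,0)$, $(0,0,1)$ respectively. Every $F\in\mathbb Z[H_p]$ can be written in exactly one way as $$F(x,y,z)=\sum_{0\le i,j,k<p}a_{ijk}\,x^iy^jz^k,\qquad a_{ijk}\in\mathbb Z;$$ put $F(1,1,1)=\sum_{0\le i,j,k<p}a_{ijk}$. Then $$M_{H_p}(F)\equiv F(1,1,1)^{p^3}\pmod{p^3}.$$ The same congruence holds for $\mathbb Z_p^3$: if $x,y,z$ are the three standard generators of $\mathbb Z_p^3$ (written multiplicatively), then every $F\in\mathbb Z[\mathbb Z_p^3]$ can be written in exactly one way as $F=\sum_{0\le i,j,k<p}a_{ijk}\,x^iy^jz^k$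 with $a_{ijk}\in\mathbb Z$, and, with $F(1,1,1)=\sum_{0\le i,j,k<p}a_{ijk}$, $$M_{\mathbb Z_p^3}(F)\equiv F(1,1,1)^{p^3}\pmod{p^3}.$$ -/

import Mathlib

/-- The Heisenberg group `H(R)` over a commutative ring `R`: the group, under matrix
multiplication, of the upper unitriangular `3 × 3` matrices with entries in `R`. -/
def heisenberg (R : Type*) [CommRing R] : Subgroup (Matrix.SpecialLinearGroup (Fin 3) R) where
  carrier := {A | ∃ a b c : R, (A : Matrix (Fin 3) (Fin 3) R) = !![1, a, c; 0, 1, b; 0, 0, 1]}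
  one_mem' := ⟨0, 0, 0, by
    ext i j; fin_cases i <;> fin_cases j <;> simp⟩
  mul_mem' := by
    rintro A B ⟨a, b, c, hA⟩ ⟨a', b', c', hB⟩
    refine ⟨a + a', b + b', c + a * b' + c', ?_⟩
    rw [Matrix.SpecialLinearGroup.coe_mul, hA, hB]
    ext i j
    fin_cases i <;> fin_cases j <;> simp [Matrix.mul_apply, Fin.sum_univ_three] <;> ring
  inv_mem' := by
    rintro A ⟨a, b, c, hA⟩
    refine ⟨-a, -b, a * b - c, ?_⟩
    rw [Matrix.SpecialLinearGroup.coe_inv, hA]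
    ext i j
    fin_cases i <;> fin_cases j <;> simp [Matrix.adjugate_fin_three]

/-- The element of `H(R)` with entries `a` (position `(1,2)`), `b` (position `(2,3)`) and `c`
(position `(1,3)`) above the diagonal. -/
def heisenbergMk {R : Type*} [CommRing R] (a b c : R) : heisenberg R :=
  ⟨⟨!![1, a, c; 0, 1, b; 0, 0, 1], by simp [Matrix.det_fin_three]⟩, ⟨a, b, c, rfl⟩⟩

/-- The generator `x` of the Heisenberg group. -/
def heisenbergX (R : Type*) [CommRing R] : heisenberg R := heisenbergMk 0 1 0

/-- The generator `y` of the Heisenberg group. -/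
def heisenbergY (R : Type*) [CommRing R] : heisenberg R := heisenbergMk 1 0 0

/-- The central generator `z` of the Heisenberg group. -/
def heisenbergZ (R : Type*) [CommRing R] : heisenberg R := heisenbergMk 0 0 1

instance heisenberg_finite (R : Type*) [CommRing R] [Finite R] : Finite (heisenberg R) :=
  Finite.of_surjective (fun t : R × R × R => heisenbergMk t.1 t.2.1 t.2.2) (by
    rintro ⟨A, a, b, c, hA⟩
    exact ⟨(a, b, c), Subtype.ext (Subtype.ext hA.symm)⟩)

open Classical in
/-- The integer group determinant `M_G(F) = det (a_{g h⁻¹})_{g, h ∈ G}` of an element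
`F = ∑ a_g g` of the group ring `ℤ[G]` of a finite group `G`. -/
noncomputable def groupDet {G : Type*} [Group G] [Finite G] (F : MonoidAlgebra ℤ G) : ℤ :=
  letI : Fintype G := Fintype.ofFinite G
  Matrix.det (Matrix.of fun g h : G => F.coeff (g * h⁻¹))

/-- The element `∑_{0 ≤ i, j, k < p} a_{ijk} x^i y^j z^k` of the group ring `ℤ[G]`, for group
elements `x, y, z`. -/
noncomputable def groupRingPoly {G : Type*} [Group G] {p : ℕ} (x y z : G)
    (a : Fin p → Fin p → Fin p → ℤ) : MonoidAlgebra ℤ G :=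
  ∑ i : Fin p, ∑ j : Fin p, ∑ k : Fin p,
    MonoidAlgebra.single (x ^ (i : ℕ) * y ^ (j : ℕ) * z ^ (k : ℕ)) (a i j k)

/-- The group `ℤ_p³`, written multiplicatively. -/
abbrev ZModCube (p : ℕ) : Type := Multiplicative (Fin 3 → ZMod p)

/-- The three standard generators of `ℤ_p³`. -/
def zmodCubeGen (p : ℕ) (i : Fin 3) : ZModCube p := Multiplicative.ofAdd (Pi.single i 1)

/-!
Let `G` have order `p ^ (n + 1)`, `n ≠ 0`, and exponent `p`, and let `C` be a central subgroup of
order `p`. The determinant of `F` is the norm of `F` from `ℤ[G]` to `ℤ`, which factors through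
the determinant `Δ ∈ ℤ[C]` of multiplication by `F` on the free `ℤ[C]`-module `ℤ[G]`. Expanding
`Δ` gives a sum of weighted elements `deg τ ∈ C` over the permutations `τ` of `G` commuting with
`C`. Conjugation of `τ` by right multiplications changes neither `deg τ` nor its weight, and if
`τ` is fixed by some `h ∉ C`, then `deg τ = 1`; hence the orbits with `deg τ ≠ 1` have size
divisible by `|G / C| = p ^ n`, and all coefficients of `Δ` away from `1` vanish modulo `p ^ n`.
Therefore the norm of `Δ` is the `p`-th power of its augmentation modulo `p ^ (n + 1)`. That
augmentation is the group determinant of the image of `F` in `ℤ[G / C]`, known modulo `p ^ n` by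
induction on `n`, and taking `p`-th powers gains the missing factor `p`. For groups of order `p`
the congruence follows from the Frobenius endomorphism of `𝔽_p[G]`.
-/

/-- The augmentation `∑ a_g g ↦ ∑ a_g` of a group ring. -/
noncomputable def augmentation (R G : Type*) [CommSemiring R] [Monoid G] :
    MonoidAlgebra R G →ₐ[R] R :=
  MonoidAlgebra.lift R R G 1

@[simp]
theorem augmentation_single {R G : Type*} [CommSemiring R] [Monoid G] (g : G) (r : R) :
    augmentation R G (MonoidAlgebra.single g r) = r := by
  simp [augmentation]

theorem augmentation_apply {R G : Type*} [CommSemiring R] [Monoid G] [Fintype G]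
    (F : MonoidAlgebra R G) : augmentation R G F = ∑ g, F.coeff g := by
  simp [augmentation, MonoidAlgebra.lift_apply, Finsupp.sum_fintype]

theorem augmentation_mapDomainRingHom {R G H : Type*} [CommSemiring R] [Monoid G] [Monoid H]
    (f : G →* H) (F : MonoidAlgebra R G) :
    augmentation R H (MonoidAlgebra.mapDomainRingHom R f F) = augmentation R G F := by
  induction F using MonoidAlgebra.induction_linear with
  | zero => simp
  | add F F' hF hF' => rw [map_add, map_add, map_add, hF, hF']
  | single g r => simp

theorem leftMulMatrix_basis_apply {R G : Type*} [CommRing R] [Group G] [Fintype G] [DecidableEq G]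
    (F : MonoidAlgebra R G) (g h : G) :
    Algebra.leftMulMatrix (MonoidAlgebra.basis G R) F g h = F.coeff (g * h⁻¹) := by
  rw [Algebra.leftMulMatrix_eq_repr_mul, MonoidAlgebra.basis_apply]
  change (F * MonoidAlgebra.single h 1).coeff g = _
  rw [MonoidAlgebra.coeff_mul_single_apply, mul_one]

theorem norm_eq_det {R G : Type*} [CommRing R] [Group G] [Fintype G] [DecidableEq G]
    (F : MonoidAlgebra R G) :
    Algebra.norm R F = (Matrix.of fun g h : G => F.coeff (g * h⁻¹)).det := by
  rw [Algebra.norm_eq_matrix_det (MonoidAlgebra.basis G R)]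
  congr 1
  ext g h
  exact leftMulMatrix_basis_apply F g h

theorem groupDet_eq_norm {G : Type*} [Group G] [Finite G] (F : MonoidAlgebra ℤ G) :
    groupDet F = Algebra.norm ℤ F := by
  classical
  let _ := Fintype.ofFinite G
  rw [norm_eq_det, groupDet]

theorem pow_prime_eq_algebraMap_augmentation {p : ℕ} [Fact p.Prime] {G : Type*} [CommGroup G]
    (hG : ∀ g : G, g ^ p = 1) (F : MonoidAlgebra (ZMod p) G) :
    F ^ p = algebraMap (ZMod p) _ (augmentation (ZMod p) G F) := by
  have : CharP (MonoidAlgebra (ZMod p) G) p :=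
    charP_of_injective_algebraMap (algebraMap (ZMod p) (MonoidAlgebra (ZMod p) G)).injective p
  have h : frobenius (MonoidAlgebra (ZMod p) G) p =
      (algebraMap (ZMod p) (MonoidAlgebra (ZMod p) G)).comp
        (augmentation (ZMod p) G : MonoidAlgebra (ZMod p) G →+* ZMod p) :=
    MonoidAlgebra.ringHom_ext
      (fun r => by simp [frobenius_def, MonoidAlgebra.single_pow, ZMod.pow_card])
      fun g => by simp [frobenius_def, MonoidAlgebra.single_pow, hG]
  exact DFunLike.congr_fun h F

theorem norm_mapRingHom {R S G : Type*} [CommRing R] [CommRing S] [Group G] [Finite G]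
    (f : R →+* S) (F : MonoidAlgebra R G) :
    Algebra.norm S (MonoidAlgebra.mapRingHom G f F) = f (Algebra.norm R F) := by
  classical
  let _ := Fintype.ofFinite G
  rw [norm_eq_det, norm_eq_det, RingHom.map_det]
  congr 1

theorem augmentation_mapRingHom {R S G : Type*} [CommSemiring R] [CommSemiring S] [Monoid G]
    (f : R →+* S) (F : MonoidAlgebra R G) :
    augmentation S G (MonoidAlgebra.mapRingHom G f F) = f (augmentation R G F) := by
  induction F using MonoidAlgebra.induction_linear with
  | zero => simp
  | add F F' hF hF' => rw [map_add, map_add, hF, hF', map_add, map_add]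
  | single g r => simp

theorem norm_modEq_augmentation_pow_prime {p : ℕ} [Fact p.Prime] {G : Type*} [CommGroup G]
    [Finite G] (hG : ∀ g : G, g ^ p = 1) (F : MonoidAlgebra ℤ G) :
    Algebra.norm ℤ F ≡ augmentation ℤ G F ^ Nat.card G [ZMOD p] := by
  rw [← ZMod.intCast_eq_intCast_iff, Int.cast_pow]
  let _ := Fintype.ofFinite G
  set F' := MonoidAlgebra.mapRingHom G (Int.castRingHom (ZMod p)) F with hF'
  calc (Algebra.norm ℤ F : ZMod p) = Algebra.norm (ZMod p) F' :=
      (norm_mapRingHom (Int.castRingHom (ZMod p)) F).symm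
    _ = Algebra.norm (ZMod p) (F' ^ p) := by rw [map_pow, ZMod.pow_card]
    _ = augmentation (ZMod p) G F' ^ Nat.card G := by
      rw [pow_prime_eq_algebraMap_augmentation hG,
        Algebra.norm_algebraMap_of_basis (MonoidAlgebra.basis G (ZMod p)), Nat.card_eq_fintype_card]
    _ = (augmentation ℤ G F : ZMod p) ^ Nat.card G := by
      rw [hF', augmentation_mapRingHom, eq_intCast]

theorem sq_dvd_det_sub_prod_diag {n R : Type*} [Fintype n] [DecidableEq n] [CommRing R]
    (A : Matrix n n R) (m : R) (hA : ∀ i j, i ≠ j → m ∣ A i j) : m ^ 2 ∣ A.det - ∏ i, A i i := by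
  rw [Matrix.det_apply, ← Finset.add_sum_erase _ _ (Finset.mem_univ (1 : Equiv.Perm n))]
  simp only [Equiv.Perm.sign_one, one_smul, Equiv.Perm.one_apply, add_sub_cancel_left]
  refine Finset.dvd_sum fun σ hσ => ?_
  rw [Units.smul_def, zsmul_eq_mul]
  refine Dvd.dvd.mul_left ?_ _
  obtain ⟨i, hi⟩ : ∃ i, σ i ≠ i := by
    by_contra! hfix
    exact (Finset.mem_erase.1 hσ).1 (Equiv.ext hfix)
  have hi' : σ (σ i) ≠ σ i := fun h => hi (σ.injective h)
  rw [← Finset.mul_prod_erase _ _ (Finset.mem_univ i), ← Finset.mul_prod_erase _ _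
    (Finset.mem_erase.2 ⟨hi, Finset.mem_univ (σ i)⟩), ← mul_assoc, sq]
  exact Dvd.dvd.mul_right (mul_dvd_mul (hA _ _ hi) (hA _ _ hi')) _

theorem sq_dvd_norm_sub_coeff_one_pow {R G : Type*} [CommRing R] [Group G] [Finite G] {m : R}
    {F : MonoidAlgebra R G} (hF : ∀ g ≠ 1, m ∣ F.coeff g) :
    m ^ 2 ∣ Algebra.norm R F - F.coeff 1 ^ Nat.card G := by
  classical
  let _ := Fintype.ofFinite G
  rw [norm_eq_det]
  simpa using sq_dvd_det_sub_prod_diag (Matrix.of fun g h : G => F.coeff (g * h⁻¹)) m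
    fun g h hgh => hF _ fun e => hgh (mul_inv_eq_one.1 e)

theorem dvd_augmentation_sub_coeff_one {R G : Type*} [CommRing R] [Group G] [Finite G] {m : R}
    {F : MonoidAlgebra R G} (hF : ∀ g ≠ 1, m ∣ F.coeff g) :
    m ∣ augmentation R G F - F.coeff 1 := by
  classical
  let _ := Fintype.ofFinite G
  rw [augmentation_apply, ← Finset.add_sum_erase _ _ (Finset.mem_univ (1 : G)),
    add_sub_cancel_left]
  exact Finset.dvd_sum fun g hg => hF g (Finset.ne_of_mem_erase hg)

theorem pow_prime_modEq_pow_prime {p n : ℕ} {a b : ℤ} (hn : n ≠ 0)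
    (h : a ≡ b [ZMOD (p : ℤ) ^ n]) : a ^ p ≡ b ^ p [ZMOD (p : ℤ) ^ (n + 1)] := by
  have hab : (a : ZMod p) = b :=
    (ZMod.intCast_eq_intCast_iff _ _ _).2 (h.of_dvd (dvd_pow_self _ hn))
  rw [Int.modEq_iff_dvd, ← geom_sum₂_mul, pow_succ']
  refine mul_dvd_mul ?_ h.dvd
  rw [← ZMod.intCast_zmod_eq_zero_iff_dvd]
  simp [hab, geom_sum₂_self]

theorem norm_modEq_augmentation_pow_of_dvd_coeff {p n : ℕ} {G : Type*} [Group G] [Finite G]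
    (hcard : Nat.card G = p) (hn : n ≠ 0) {F : MonoidAlgebra ℤ G}
    (hF : ∀ g ≠ 1, (p : ℤ) ^ n ∣ F.coeff g) :
    Algebra.norm ℤ F ≡ augmentation ℤ G F ^ p [ZMOD (p : ℤ) ^ (n + 1)] := by
  have hnorm : Algebra.norm ℤ F ≡ F.coeff 1 ^ p [ZMOD (p : ℤ) ^ (n + 1)] := by
    have h := sq_dvd_norm_sub_coeff_one_pow hF
    rw [hcard, ← pow_mul] at h
    exact (Int.modEq_iff_dvd.2 h).symm.of_dvd (pow_dvd_pow _ (by lia))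
  exact hnorm.trans <|
    pow_prime_modEq_pow_prime hn (Int.modEq_iff_dvd.2 (dvd_augmentation_sub_coeff_one hF))

theorem prod_eq_prod_orbit_out_pow_card {G X M : Type*} [Group G] [MulAction G X] [Fintype X]
    [Fintype (MulAction.orbitRel.Quotient G X)] [CommMonoid M] {u : X → M}
    (hu : ∀ (g : G) x, u (g • x) = u x) :
    ∏ x, u x = ∏ ω : MulAction.orbitRel.Quotient G X,
      u ω.out ^ Nat.card (MulAction.orbit G ω.out) := by
  classical
  rw [← Equiv.prod_comp (MulAction.selfEquivSigmaOrbits G X).symm, Fintype.prod_sigma]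
  refine Finset.prod_congr rfl fun ω _ => ?_
  have hconst : ∀ y : MulAction.orbit G ω.out,
      u ((MulAction.selfEquivSigmaOrbits G X).symm ⟨ω, y⟩) = u ω.out := by
    rintro ⟨_, g, rfl⟩
    exact hu g _
  simp only [hconst, Finset.prod_const, Finset.card_univ, Nat.card_eq_fintype_card]

theorem dvd_sum_of_dvd_card_orbit {G X R : Type*} [Group G] [MulAction G X] [Fintype X]
    [Semiring R] {u : X → R} (hu : ∀ (g : G) x, u (g • x) = u x) {N : ℕ}
    (hN : ∀ x, u x ≠ 0 → N ∣ Nat.card (MulAction.orbit G x)) : (N : R) ∣ ∑ x, u x := by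
  classical
  have hsum : ∑ x, u x = ∑ ω : MulAction.orbitRel.Quotient G X,
      Nat.card (MulAction.orbit G ω.out) • u ω.out :=
    prod_eq_prod_orbit_out_pow_card (M := Multiplicative R) hu
  rw [hsum]
  refine Finset.dvd_sum fun ω _ => ?_
  rw [nsmul_eq_mul]
  by_cases h0 : u ω.out = 0
  · simp [h0]
  · exact Dvd.dvd.mul_right (Nat.cast_dvd_cast (hN _ h0)) _

theorem prod_eq_one_of_isCancelSMul {H X M : Type*} [Group H] [MulAction H X]
    [IsCancelSMul H X] [Fintype X] [CommMonoid M] {u : X → M} (hu : ∀ (h : H) x, u (h • x) = u x)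
    (hM : ∀ a : M, a ^ Nat.card H = 1) : ∏ x, u x = 1 := by
  classical
  rw [prod_eq_prod_orbit_out_pow_card hu]
  refine Finset.prod_eq_one fun ω _ => ?_
  rw [Nat.card_coe_set_eq, ← MulAction.index_stabilizer, IsCancelSMul.stabilizer_eq_bot,
    Subgroup.index_bot, hM]

theorem nonempty_mulActionHom_of_isCancelSMul (C X : Type*) [Group C] [MulAction C X]
    [IsCancelSMul C X] : Nonempty (X →[C] C) := by
  let r : X → X := fun x => (Quotient.mk (MulAction.orbitRel C X) x).out
  have hr : ∀ (c : C) x, r (c • x) = r x := fun c x =>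
    congrArg Quotient.out (Quotient.sound (MulAction.orbitRel_apply.2 ⟨c, rfl⟩))
  have hmem : ∀ x, ∃ c : C, c • r x = x := fun x =>
    MulAction.orbitRel_apply.1 (Quotient.exact (Quotient.out_eq (Quotient.mk _ x)).symm)
  choose e he using hmem
  refine ⟨e, fun c x => IsCancelSMul.right_cancel _ _ (r x) ?_⟩
  rw [id, smul_assoc, he, ← hr c, he]

section EquivariantPerm

variable {G : Type*} [Group G]

/-- The permutations of the set `G` that commute with left multiplication by elements of `C`. -/
def equivariantPerm (C : Subgroup G) : Subgroup (Equiv.Perm G) :=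
  Subgroup.centralizer (MulAction.toPermHom C G).range

theorem mem_equivariantPerm_iff {C : Subgroup G} {τ : Equiv.Perm G} :
    τ ∈ equivariantPerm C ↔ ∀ (c : C) g, τ (c * g) = c * τ g := by
  simp only [equivariantPerm, Subgroup.mem_centralizer_iff, MonoidHom.coe_range,
    Set.forall_mem_range, Equiv.ext_iff]
  exact forall₂_congr fun c g => eq_comm

theorem equivariantPerm_coe_mul {C : Subgroup G} (τ : equivariantPerm C) (c : C) (g : G) :
    τ.1 (c * g) = c * τ.1 g :=
  mem_equivariantPerm_iff.1 τ.2 c g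

/-- The action of `G` on itself by right multiplication, `h ↦ (g ↦ g * h⁻¹)`. -/
def rightMul (C : Subgroup G) : G →* equivariantPerm C where
  toFun h := ⟨Equiv.mulRight h⁻¹, mem_equivariantPerm_iff.2 fun c g => mul_assoc (c : G) g h⁻¹⟩
  map_one' := by ext; simp
  map_mul' h h' := by ext; simp [mul_assoc]

end EquivariantPerm

open scoped IsMulCommutative

theorem coeff_mapDomainRingHom_mk {R G : Type*} [CommSemiring R] [Group G] (N : Subgroup G)
    [N.Normal] [Fintype N] (F : MonoidAlgebra R G) (g : G) :
    (MonoidAlgebra.mapDomainRingHom R (QuotientGroup.mk' N) F).coeff (g : G ⧸ N) =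
      ∑ c : N, F.coeff (g * c) := by
  classical
  induction F using MonoidAlgebra.induction_linear with
  | zero => simp
  | add F F' hF hF' =>
    simp only [map_add, MonoidAlgebra.coeff_add, Finsupp.add_apply, hF, hF',
      Finset.sum_add_distrib]
  | single g' r =>
    simp only [MonoidAlgebra.mapDomainRingHom_apply, MonoidAlgebra.mapDomain_single,
      MonoidAlgebra.coeff_single, Finsupp.single_apply, QuotientGroup.coe_mk']
    by_cases hmk : (g' : G ⧸ N) = g
    · have hmem : g⁻¹ * g' ∈ N := QuotientGroup.eq.1 hmk.symm
      have heq : ∀ c : N, g' = g * c ↔ ⟨g⁻¹ * g', hmem⟩ = c := fun c => by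
        rw [Subtype.ext_iff, inv_mul_eq_iff_eq_mul]
      simp only [hmk, heq, if_true, Finset.sum_ite_eq, Finset.mem_univ]
    · have hne : ∀ c : N, g' ≠ g * c := fun c hc =>
        hmk (hc ▸ QuotientGroup.mk_mul_of_mem g c.2)
      simp only [hmk, hne, if_false, Finset.sum_const_zero]

section BlockMatrix

variable {R G : Type*} [CommRing R] [Group G] (C : Subgroup G) [Fintype C]

/-- For central `C`, the matrix of multiplication by `F` on `R[G]`, a free `R[C]`-module with basis
the coset representatives. -/
noncomputable def blockMatrix (F : MonoidAlgebra R G) :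
    Matrix (G ⧸ C) (G ⧸ C) (MonoidAlgebra R C) :=
  Matrix.of fun q q' => ∑ c : C, MonoidAlgebra.single c (F.coeff (c * q.out * q'.out⁻¹))

theorem coeff_blockMatrix (F : MonoidAlgebra R G) (q q' : G ⧸ C) (c : C) :
    (blockMatrix C F q q').coeff c = F.coeff (c * q.out * q'.out⁻¹) := by
  classical
  simp [blockMatrix, Finsupp.single_apply]

end BlockMatrix

theorem disjoint_zpowers_of_notMem {G : Type*} [Group G] {C : Subgroup G} {h : G}
    (hh : (orderOf h).Prime) (hC : h ∉ C) : Disjoint C (Subgroup.zpowers h) := by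
  have : Fact (Nat.card (Subgroup.zpowers h)).Prime := ⟨by rwa [Nat.card_zpowers]⟩
  rw [← Subgroup.subgroupOf_eq_bot]
  refine (C.subgroupOf (Subgroup.zpowers h)).eq_bot_or_eq_top_of_prime_card.resolve_right ?_
  rwa [Subgroup.subgroupOf_eq_top, Subgroup.zpowers_le]

/-- `C` is a subgroup of the center of `G`; a class, so that its normality and commutativity are
found by instance search. -/
class IsCentralSubgroup {G : Type*} [Group G] (C : Subgroup G) : Prop where
  le_center : C ≤ Subgroup.center G

namespace IsCentralSubgroup

variable {G : Type*} [Group G] (C : Subgroup G) [IsCentralSubgroup C]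

theorem coe_mul_comm {C : Subgroup G} [IsCentralSubgroup C] (c : C) (g : G) : c * g = g * c :=
  (Subgroup.mem_center_iff.1 (le_center c.2) g).symm

instance normal : C.Normal :=
  ⟨fun c hc g => by rwa [← coe_mul_comm ⟨c, hc⟩ g, mul_inv_cancel_right]⟩

instance isMulCommutative : IsMulCommutative C :=
  ⟨⟨fun c c' => Subtype.ext (coe_mul_comm c c')⟩⟩

theorem mk_coe_mul {C : Subgroup G} [IsCentralSubgroup C] (c : C) (g : G) :
    ((c * g : G) : G ⧸ C) = g := by
  rw [coe_mul_comm, QuotientGroup.mk_mul_of_mem _ c.2]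

/-- The factor `c ∈ C` in the decomposition `g = c * q.out`, `q = gC`. -/
noncomputable def centralPart (g : G) : C :=
  ⟨g * (g : G ⧸ C).out⁻¹, by
    rw [← QuotientGroup.eq_one_iff, QuotientGroup.mk_mul, QuotientGroup.mk_inv,
      QuotientGroup.out_eq', mul_inv_cancel]⟩

theorem centralPart_mul_out (g : G) : centralPart C g * (g : G ⧸ C).out = g :=
  inv_mul_cancel_right _ _

theorem centralPart_coe_mul (c : C) (g : G) : centralPart C (c * g) = c * centralPart C g :=
  Subtype.ext <| by simp only [centralPart, mk_coe_mul, Subgroup.coe_mul, mul_assoc]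

theorem centralPart_out (q : G ⧸ C) : centralPart C q.out = 1 :=
  Subtype.ext <| by simp [centralPart]

/-- The bijection `g ↦ (gC, centralPart g)` given by the choice of coset representatives. -/
noncomputable def quotientProdEquiv : G ≃ (G ⧸ C) × C where
  toFun g := (g, centralPart C g)
  invFun t := t.2 * t.1.out
  left_inv := centralPart_mul_out C
  right_inv := fun ⟨q, c⟩ => by
    simp only [mk_coe_mul, QuotientGroup.out_eq', centralPart_coe_mul, centralPart_out, mul_one]

theorem apply_out_mk {α : Type*} {w : G → α} (hw : ∀ (c : C) g, w (c * g) = w g) (g : G) :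
    w (g : G ⧸ C).out = w g := by
  rw [← hw (centralPart C g), centralPart_mul_out]

theorem mk_equivariantPerm_out_mk (τ : equivariantPerm C) (g : G) :
    (τ.1 (g : G ⧸ C).out : G ⧸ C) = τ.1 g :=
  apply_out_mk C (w := fun g => (τ.1 g : G ⧸ C))
    (fun c g => by rw [equivariantPerm_coe_mul, mk_coe_mul]) g

/-- The permutation of `G ⧸ C` induced by a `C`-equivariant permutation of `G`. -/
noncomputable def quotientPerm : equivariantPerm C →* Equiv.Perm (G ⧸ C) :=
  MonoidHom.toHomPerm
    { toFun τ q := (τ.1 q.out : G ⧸ C)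
      map_one' := funext fun q => q.out_eq'
      map_mul' τ τ' := funext fun q => (mk_equivariantPerm_out_mk C τ (τ'.1 q.out)).symm }

theorem quotientPerm_mk (τ : equivariantPerm C) (g : G) :
    quotientPerm C τ g = (τ.1 g : G ⧸ C) :=
  mk_equivariantPerm_out_mk C τ g

theorem centralPart_mul_out_quotientPerm (τ : equivariantPerm C) (q : G ⧸ C) :
    centralPart C (τ.1 q.out) * (quotientPerm C τ q).out = τ.1 q.out :=
  centralPart_mul_out C _

/-- The `C`-equivariant permutation with `q.out ↦ f q * (σ q).out`. -/
noncomputable def equivariantPermMk (σ : Equiv.Perm (G ⧸ C)) (f : G ⧸ C → C) :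
    equivariantPerm C :=
  ⟨(quotientProdEquiv C).trans <| (Equiv.prodShear σ fun q => Equiv.mulRight (f q)).trans
      (quotientProdEquiv C).symm,
    mem_equivariantPerm_iff.2 fun c g => by
      change ((centralPart C (c * g) * f (c * g : G) : C) : G) * (σ (c * g : G)).out =
        c * ((centralPart C g * f g : C) * (σ g).out)
      rw [mk_coe_mul, centralPart_coe_mul, mul_assoc c, Subgroup.coe_mul C c, mul_assoc]⟩

theorem equivariantPermMk_out (σ : Equiv.Perm (G ⧸ C)) (f : G ⧸ C → C) (q : G ⧸ C) :
    (equivariantPermMk C σ f).1 q.out = f q * (σ q).out := by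
  change ((centralPart C q.out * f (q.out : G ⧸ C) : C) : G) * (σ (q.out : G ⧸ C)).out = _
  rw [centralPart_out, QuotientGroup.out_eq', one_mul]

theorem quotientPerm_equivariantPermMk (σ : Equiv.Perm (G ⧸ C)) (f : G ⧸ C → C) :
    quotientPerm C (equivariantPermMk C σ f) = σ := by
  ext q
  change ((equivariantPermMk C σ f).1 q.out : G ⧸ C) = σ q
  rw [equivariantPermMk_out, mk_coe_mul, QuotientGroup.out_eq']

theorem centralPart_equivariantPermMk_out (σ : Equiv.Perm (G ⧸ C)) (f : G ⧸ C → C) (q : G ⧸ C) :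
    centralPart C ((equivariantPermMk C σ f).1 q.out) = f q := by
  rw [equivariantPermMk_out, centralPart_coe_mul, centralPart_out, mul_one]

theorem equivariantPerm_ext {τ τ' : equivariantPerm C}
    (h : ∀ q : G ⧸ C, τ.1 q.out = τ'.1 q.out) : τ = τ' :=
  Subtype.ext <| Equiv.ext fun g => by
    rw [← centralPart_mul_out C g, equivariantPerm_coe_mul, equivariantPerm_coe_mul, h]

/-- A `C`-equivariant permutation is determined by its values on the coset representatives, that
is, by the cosets of these values and their parts in `C`. -/
noncomputable def equivariantPermEquiv :
    equivariantPerm C ≃ Equiv.Perm (G ⧸ C) × (G ⧸ C → C) where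
  toFun τ := (quotientPerm C τ, fun q => centralPart C (τ.1 q.out))
  invFun t := equivariantPermMk C t.1 t.2
  left_inv τ := equivariantPerm_ext C fun q => by
    rw [equivariantPermMk_out, centralPart_mul_out_quotientPerm]
  right_inv t := Prod.ext (quotientPerm_equivariantPermMk C t.1 t.2)
    (funext (centralPart_equivariantPermMk_out C t.1 t.2))

theorem isCancelSMul_quotient_of_disjoint {H : Subgroup G} (hH : Disjoint C H) :
    IsCancelSMul C (G ⧸ H) := by
  refine isCancelSMul_iff_eq_one_of_smul_eq.2 fun c q => ?_
  induction q using QuotientGroup.induction_on with | H g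
  intro (hcg : ((c * g : G) : G ⧸ H) = g)
  rw [coe_mul_comm] at hcg
  have hcH : (c : G) ∈ H := by simpa using QuotientGroup.eq.1 hcg.symm
  exact Subtype.ext (Subgroup.disjoint_def.1 hH c.2 hcH)

section Degree

variable [Fintype (G ⧸ C)]

/-- The determinant, with the sign of the permutation left out, of a `C`-equivariant permutation
of `G` viewed as a monomial matrix over `C` indexed by `G ⧸ C`. -/
noncomputable def deg : equivariantPerm C →* C where
  toFun τ := ∏ q : G ⧸ C, centralPart C (τ.1 q.out)
  map_one' := Finset.prod_eq_one fun q _ => centralPart_out C q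
  map_mul' τ τ' := by
    have hmul : ∀ q : G ⧸ C, centralPart C ((τ * τ').1 q.out) =
        centralPart C (τ.1 (quotientPerm C τ' q).out) * centralPart C (τ'.1 q.out) := fun q => by
      rw [Subgroup.coe_mul, Equiv.Perm.mul_apply, ← centralPart_mul_out_quotientPerm C τ' q,
        equivariantPerm_coe_mul, centralPart_coe_mul, mul_comm, centralPart_coe_mul,
        centralPart_out, mul_one]
    simp only [hmul, Finset.prod_mul_distrib]
    rw [Equiv.prod_comp (quotientPerm C τ') fun q : G ⧸ C => centralPart C (τ.1 q.out)]

theorem deg_apply (τ : equivariantPerm C) : deg C τ = ∏ q : G ⧸ C, centralPart C (τ.1 q.out) :=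
  rfl

theorem deg_eq_prod_div (e : G →[C] C) (τ : equivariantPerm C) :
    deg C τ = ∏ q : G ⧸ C, e (τ.1 q.out) / e q.out := by
  have he : ∀ q : G ⧸ C,
      e (τ.1 q.out) = centralPart C (τ.1 q.out) * e (quotientPerm C τ q).out := fun q => by
    rw [← smul_eq_mul, ← map_smul, Subgroup.smul_def, smul_eq_mul,
      centralPart_mul_out_quotientPerm]
  rw [deg_apply, Finset.prod_div_distrib,
    ← Equiv.prod_comp (quotientPerm C τ) fun q : G ⧸ C => e q.out, ← Finset.prod_div_distrib]
  exact Finset.prod_congr rfl fun q _ => by rw [he, mul_div_cancel_right]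

theorem prod_out_eq_one_of_mul_right_invariant {M : Type*} [CommMonoid M] {H : Subgroup G}
    (hH : Disjoint C H) (hM : ∀ a : M, a ^ Nat.card H = 1) {w : G → M}
    (hwC : ∀ (c : C) g, w (c * g) = w g) (hwH : ∀ (h : H) g, w (g * (h : G)⁻¹) = w g) :
    ∏ q : G ⧸ C, w q.out = 1 := by
  let _ : MulAction H (G ⧸ C) :=
    MulAction.compHom _ ((quotientPerm C).comp ((rightMul C).comp H.subtype))
  have hsmul : ∀ (h : H) (g : G), h • (g : G ⧸ C) = (g * (h : G)⁻¹ : G) := fun h g =>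
    quotientPerm_mk C (rightMul C h) g
  have : IsCancelSMul H (G ⧸ C) := by
    refine isCancelSMul_iff_eq_one_of_smul_eq.2 fun h q hq => ?_
    induction q using QuotientGroup.induction_on with | H g
    rw [hsmul] at hq
    have hhC : (h : G) ∈ C := by simpa using QuotientGroup.eq.1 hq
    exact Subtype.ext (Subgroup.disjoint_def.1 hH hhC h.2)
  refine prod_eq_one_of_isCancelSMul (H := H) (fun h q => ?_) hM
  induction q using QuotientGroup.induction_on with | H g
  rw [hsmul, apply_out_mk C hwC, apply_out_mk C hwC, hwH]

theorem deg_eq_one_of_commute {H : Subgroup G} (hH : Disjoint C H)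
    (hC : ∀ c : C, c ^ Nat.card H = 1) {τ : equivariantPerm C}
    (hτ : ∀ h ∈ H, Commute (rightMul C h) τ) : deg C τ = 1 := by
  -- Instead of the section `Quotient.out` use a `C`-equivariant `e : G → C` which is also right
  -- `H`-invariant: then each factor of `deg_eq_prod_div` is constant along the free `H`-orbits.
  have := isCancelSMul_quotient_of_disjoint C hH
  obtain ⟨e₀⟩ := nonempty_mulActionHom_of_isCancelSMul C (G ⧸ H)
  let e : G →[C] C := ⟨fun g => e₀ g, fun c g => e₀.map_smul c g⟩
  have heC : ∀ (c : C) g, e (c * g) = c * e g := e.map_smul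
  have heH : ∀ (h : H) (g : G), e (g * (h : G)⁻¹) = e g := fun h g =>
    congrArg e₀ (QuotientGroup.mk_mul_of_mem g (inv_mem h.2))
  have hτH : ∀ (h : H) (g : G), τ.1 (g * (h : G)⁻¹) = τ.1 g * (h : G)⁻¹ := fun h g =>
    (DFunLike.congr_fun (congrArg Subtype.val (hτ h h.2).eq) g).symm
  rw [deg_eq_prod_div C e]
  refine prod_out_eq_one_of_mul_right_invariant C hH hC (w := fun g => e (τ.1 g) / e g)
    (fun c g => ?_) fun h g => ?_
  · rw [equivariantPerm_coe_mul, heC, heC, mul_div_mul_left_eq_div]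
  · rw [hτH, heH, heH]

end Degree

section BlockMatrix

variable [Fintype (G ⧸ C)] [DecidableEq (G ⧸ C)] {R : Type*} [CommRing R]

/-- The contribution of `τ`, a `C`-equivariant permutation of `G`, to the determinant of the block
matrix of `F`. -/
noncomputable def weight (F : MonoidAlgebra R G) (τ : equivariantPerm C) : R :=
  (Equiv.Perm.sign (quotientPerm C τ) : ℤ) * ∏ q : G ⧸ C, F.coeff (τ.1 q.out * q.out⁻¹)

theorem weight_conj (F : MonoidAlgebra R G) (h : G) (τ : equivariantPerm C) :
    weight C F (rightMul C h * τ * (rightMul C h)⁻¹) = weight C F τ := by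
  let w : G → R := fun g => F.coeff (τ.1 g * g⁻¹)
  have hw : ∀ (c : C) g, w (c * g) = w g := fun c g => by
    simp only [w]
    rw [equivariantPerm_coe_mul, coe_mul_comm, coe_mul_comm, mul_inv_rev, mul_assoc,
      mul_inv_cancel_left]
  have hfactor : ∀ q : G ⧸ C,
      F.coeff ((rightMul C h * τ * (rightMul C h)⁻¹).1 q.out * q.out⁻¹) =
        w (quotientPerm C (rightMul C h⁻¹) q).out := fun q => by
    change F.coeff (τ.1 (q.out * h⁻¹⁻¹) * h⁻¹ * q.out⁻¹) =
      w ((q.out * h⁻¹⁻¹ : G) : G ⧸ C).out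
    rw [apply_out_mk C hw]
    simp only [w, mul_inv_rev, inv_inv, mul_assoc]
  have hsign : Equiv.Perm.sign (quotientPerm C (rightMul C h * τ * (rightMul C h)⁻¹)) =
      Equiv.Perm.sign (quotientPerm C τ) := by
    rw [map_mul, map_mul, map_inv, map_mul, map_mul, map_inv, mul_right_comm, mul_inv_cancel,
      one_mul]
  simp only [weight, hsign, hfactor]
  rw [Equiv.prod_comp (quotientPerm C (rightMul C h⁻¹)) fun q : G ⧸ C => w q.out]

variable [Fintype C]

theorem norm_det_blockMatrix (F : MonoidAlgebra R G) :
    Algebra.norm R (blockMatrix C F).det = Algebra.norm R F := by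
  classical
  let _ : Fintype G := Fintype.ofEquiv _ (quotientProdEquiv C).symm
  rw [Algebra.norm_eq_matrix_det (MonoidAlgebra.basis C R), norm_eq_det,
    ← Matrix.det_submatrix_equiv_self (quotientProdEquiv C).symm (Matrix.of _)]
  refine (Matrix.det_det _ (Algebra.leftMulMatrix (MonoidAlgebra.basis C R) :
    MonoidAlgebra R C →+* Matrix C C R)).trans (congrArg _ ?_)
  ext ⟨q, c⟩ ⟨q', c'⟩
  change Algebra.leftMulMatrix (MonoidAlgebra.basis C R) (blockMatrix C F q q') c c' =
    F.coeff (c * q.out * (c' * q'.out)⁻¹)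
  rw [leftMulMatrix_basis_apply, coeff_blockMatrix, mul_inv_rev, ← Subgroup.coe_inv,
    ← coe_mul_comm c'⁻¹, Subgroup.coe_mul]
  simp only [mul_assoc, coe_mul_comm c'⁻¹]

theorem augmentation_det_blockMatrix (F : MonoidAlgebra R G) :
    augmentation R C (blockMatrix C F).det =
      Algebra.norm R (MonoidAlgebra.mapDomainRingHom R (QuotientGroup.mk' C) F) := by
  rw [norm_eq_det, AlgHom.map_det]
  congr 1
  ext q q'
  have hmk : q * q'⁻¹ = (q.out * q'.out⁻¹ : G) := by
    rw [QuotientGroup.mk_mul, QuotientGroup.mk_inv, QuotientGroup.out_eq', QuotientGroup.out_eq']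
  simp only [AlgHom.mapMatrix_apply, Matrix.map_apply, augmentation_apply, coeff_blockMatrix,
    Matrix.of_apply, hmk, coeff_mapDomainRingHom_mk, mul_assoc, coe_mul_comm]

theorem det_blockMatrix [Fintype (equivariantPerm C)] (F : MonoidAlgebra R G) :
    (blockMatrix C F).det =
      ∑ τ : equivariantPerm C, MonoidAlgebra.single (deg C τ) (weight C F τ) := by
  classical
  rw [← Equiv.sum_comp (equivariantPermEquiv C).symm, Fintype.sum_prod_type, Matrix.det_apply]
  refine Finset.sum_congr rfl fun σ _ => ?_
  simp only [blockMatrix, Matrix.of_apply, Finset.prod_univ_sum, Fintype.piFinset_univ,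
    MonoidAlgebra.prod_single, Finset.smul_sum]
  refine Finset.sum_congr rfl fun f _ => ?_
  change _ = MonoidAlgebra.single (deg C (equivariantPermMk C σ f))
    (weight C F (equivariantPermMk C σ f))
  have hdeg : deg C (equivariantPermMk C σ f) = ∏ q, f q :=
    Finset.prod_congr rfl fun q _ => centralPart_equivariantPermMk_out C σ f q
  simp only [hdeg, weight, quotientPerm_equivariantPermMk, equivariantPermMk_out,
    Units.smul_def, MonoidAlgebra.smul_single, zsmul_eq_mul]

theorem index_dvd_coeff_det_blockMatrix [Finite G] {p : ℕ} [Fact p.Prime]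
    (hG : ∀ g : G, g ^ p = 1) (F : MonoidAlgebra R G) {c : C} (hc : c ≠ 1) :
    (C.index : R) ∣ (blockMatrix C F).det.coeff c := by
  classical
  let _ := Fintype.ofFinite (equivariantPerm C)
  let _ : MulAction G (equivariantPerm C) :=
    MulAction.compHom _ (MulAut.conj.comp (rightMul C))
  have hsmul : ∀ (h : G) (τ : equivariantPerm C),
      h • τ = rightMul C h * τ * (rightMul C h)⁻¹ := fun _ _ => rfl
  simp only [det_blockMatrix, MonoidAlgebra.coeff_sum, MonoidAlgebra.coeff_single,
    Finsupp.finsetSum_apply, Finsupp.single_apply]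
  refine dvd_sum_of_dvd_card_orbit (G := G) (fun h τ => ?_) fun τ hτ => ?_
  · rw [hsmul, weight_conj, map_mul, map_mul, map_inv, mul_right_comm, mul_inv_cancel, one_mul]
  have hdeg : deg C τ ≠ 1 := fun h => by simp_all
  have hstab : MulAction.stabilizer G τ ≤ C := fun h hh => by
    by_contra hhC
    have hord : orderOf h = p := orderOf_eq_prime (hG h) fun h1 => hhC (h1 ▸ one_mem C)
    refine hdeg (deg_eq_one_of_commute C (H := Subgroup.zpowers h)
      (disjoint_zpowers_of_notMem (hord.symm ▸ Fact.out) hhC) (fun c => ?_) fun h' hh' => ?_)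
    · rw [Nat.card_zpowers, hord]
      exact Subtype.ext (hG c)
    · have hcomm : Commute (rightMul C h) τ := mul_inv_eq_iff_eq_mul.1 (hsmul h τ ▸ hh)
      obtain ⟨k, rfl⟩ := Subgroup.mem_zpowers_iff.1 hh'
      rw [map_zpow]
      exact hcomm.zpow_left k
  rw [Nat.card_coe_set_eq, ← MulAction.index_stabilizer]
  exact Subgroup.index_dvd_of_le hstab

end BlockMatrix

end IsCentralSubgroup

theorem exists_isCentralSubgroup_card_eq_prime {p n : ℕ} [hp : Fact p.Prime] {G : Type*} [Group G]
    (hn : n ≠ 0) (hcard : Nat.card G = p ^ n) :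
    ∃ C : Subgroup G, IsCentralSubgroup C ∧ Nat.card C = p := by
  obtain ⟨k, hk, hcenter⟩ := IsPGroup.card_center_eq_prime_pow hcard (Nat.pos_of_ne_zero hn)
  have := Nat.finite_of_card_ne_zero (hcard ▸ pow_ne_zero n hp.out.ne_zero)
  obtain ⟨z, hz⟩ := exists_prime_orderOf_dvd_card' p (hcenter ▸ dvd_pow_self p hk.ne')
  refine ⟨Subgroup.zpowers z, ⟨Subgroup.zpowers_le.2 z.2⟩, ?_⟩
  rw [Nat.card_zpowers, Subgroup.orderOf_coe, hz]

theorem norm_modEq_augmentation_pow_of_quotient {p n : ℕ} [Fact p.Prime] {G : Type*} [Group G]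
    [Finite G] (hG : ∀ g : G, g ^ p = 1) (hn : n ≠ 0) {C : Subgroup G} [IsCentralSubgroup C]
    (hC : Nat.card C = p) (hindex : C.index = p ^ n)
    (hquot : ∀ F : MonoidAlgebra ℤ (G ⧸ C),
      Algebra.norm ℤ F ≡ augmentation ℤ (G ⧸ C) F ^ p ^ n [ZMOD (p : ℤ) ^ n])
    (F : MonoidAlgebra ℤ G) :
    Algebra.norm ℤ F ≡ augmentation ℤ G F ^ p ^ (n + 1) [ZMOD (p : ℤ) ^ (n + 1)] := by
  classical
  let _ := Fintype.ofFinite C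
  let _ := Fintype.ofFinite (G ⧸ C)
  let Δ := (blockMatrix C F).det
  have hΔ : ∀ c ≠ 1, (p : ℤ) ^ n ∣ Δ.coeff c := fun c hc => by
    simpa only [hindex, Nat.cast_pow] using
      IsCentralSubgroup.index_dvd_coeff_det_blockMatrix C hG F hc
  have hΔ_aug : augmentation ℤ C Δ ≡ augmentation ℤ G F ^ p ^ n [ZMOD (p : ℤ) ^ n] := by
    rw [IsCentralSubgroup.augmentation_det_blockMatrix,
      ← augmentation_mapDomainRingHom (QuotientGroup.mk' C)]
    exact hquot _
  calc Algebra.norm ℤ F = Algebra.norm ℤ Δ := (IsCentralSubgroup.norm_det_blockMatrix C F).symm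
    _ ≡ augmentation ℤ C Δ ^ p [ZMOD (p : ℤ) ^ (n + 1)] :=
      norm_modEq_augmentation_pow_of_dvd_coeff hC hn hΔ
    _ ≡ (augmentation ℤ G F ^ p ^ n) ^ p [ZMOD (p : ℤ) ^ (n + 1)] :=
      pow_prime_modEq_pow_prime hn hΔ_aug
    _ = augmentation ℤ G F ^ p ^ (n + 1) := by rw [← pow_mul, pow_succ]

theorem norm_modEq_augmentation_pow_of_exponent_prime {p : ℕ} [hp : Fact p.Prime] (n : ℕ) :
    ∀ {G : Type*} [Group G], Nat.card G = p ^ n → (∀ g : G, g ^ p = 1) →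
      ∀ F : MonoidAlgebra ℤ G,
        Algebra.norm ℤ F ≡ augmentation ℤ G F ^ p ^ n [ZMOD (p : ℤ) ^ n] := by
  induction n with
  | zero =>
    intros
    rw [pow_zero]
    exact Int.modEq_one
  | succ n ih =>
    intro G _ hcard hG F
    have := Nat.finite_of_card_ne_zero (hcard ▸ pow_ne_zero (n + 1) hp.out.ne_zero)
    rcases eq_or_ne n 0 with rfl | hn
    · have := isCyclic_of_prime_card (hcard.trans (pow_one p))
      let _ : CommGroup G := IsCyclic.commGroup
      simpa [hcard] using norm_modEq_augmentation_pow_prime hG F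
    · obtain ⟨C, _, hC⟩ := exists_isCentralSubgroup_card_eq_prime n.succ_ne_zero hcard
      have hindex : C.index = p ^ n := by
        rw [← Nat.mul_right_inj hp.out.ne_zero, ← pow_succ', ← hcard, ← hC, C.card_mul_index]
      have hquot : ∀ q : G ⧸ C, q ^ p = 1 := fun q => by
        induction q using QuotientGroup.induction_on with | H g
        rw [← QuotientGroup.mk_pow, hG, QuotientGroup.mk_one]
      exact norm_modEq_augmentation_pow_of_quotient hG hn hC hindex (ih hindex hquot) F

section Monomial

variable {G : Type*} [Group G] {p : ℕ} {x y z : G}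

/-- The monomials `x ^ i * y ^ j * z ^ k` with exponents in `Fin p`, those of `groupRingPoly`;
bijectivity of this map is the normal form property of the generators `x`, `y`, `z`. -/
def monomial (x y z : G) (t : Fin p × Fin p × Fin p) : G :=
  x ^ (t.1 : ℕ) * y ^ (t.2.1 : ℕ) * z ^ (t.2.2 : ℕ)

theorem augmentation_groupRingPoly (a : Fin p → Fin p → Fin p → ℤ) :
    augmentation ℤ G (groupRingPoly x y z a) = ∑ i, ∑ j, ∑ k, a i j k := by
  simp only [groupRingPoly, map_sum, augmentation_single]

theorem coeff_groupRingPoly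
    (h : Function.Injective (monomial x y z : Fin p × Fin p × Fin p → G))
    (a : Fin p → Fin p → Fin p → ℤ) (i j k : Fin p) :
    (groupRingPoly x y z a).coeff (monomial x y z (i, j, k)) = a i j k := by
  classical
  have hsum : groupRingPoly x y z a = ∑ t : Fin p × Fin p × Fin p,
      MonoidAlgebra.single (monomial x y z t) (a t.1 t.2.1 t.2.2) := by
    simp only [groupRingPoly, monomial, Fintype.sum_prod_type]
  simp [hsum, Finsupp.single_apply, h.eq_iff]

theorem existsUnique_eq_groupRingPoly
    (h : Function.Bijective (monomial x y z : Fin p × Fin p × Fin p → G))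
    (F : MonoidAlgebra ℤ G) :
    ∃! a : Fin p → Fin p → Fin p → ℤ, F = groupRingPoly x y z a := by
  refine ⟨fun i j k => F.coeff (monomial x y z (i, j, k)), ?_, ?_⟩
  · ext g
    obtain ⟨⟨i, j, k⟩, rfl⟩ := h.surjective g
    rw [coeff_groupRingPoly h.injective]
  · rintro a rfl
    funext i j k
    exact (coeff_groupRingPoly h.injective a i j k).symm

theorem theorem3p1_general [Fact p.Prime] [Finite G] (hG : ∀ g : G, g ^ p = 1)
    (h : Function.Bijective (monomial x y z : Fin p × Fin p × Fin p → G))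
    (F : MonoidAlgebra ℤ G) :
    (∃! a : Fin p → Fin p → Fin p → ℤ, F = groupRingPoly x y z a) ∧
      ∀ a : Fin p → Fin p → Fin p → ℤ, F = groupRingPoly x y z a →
        groupDet F ≡ (∑ i : Fin p, ∑ j : Fin p, ∑ k : Fin p, a i j k) ^ (p ^ 3)
          [ZMOD (p : ℤ) ^ 3] := by
  have hcard : Nat.card G = p ^ 3 := by
    rw [← Nat.card_eq_of_bijective _ h, Nat.card_prod, Nat.card_prod, Nat.card_fin]
    ring
  refine ⟨existsUnique_eq_groupRingPoly h F, ?_⟩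
  rintro a rfl
  simpa only [groupDet_eq_norm, augmentation_groupRingPoly] using
    norm_modEq_augmentation_pow_of_exponent_prime 3 hcard hG (groupRingPoly x y z a)

end Monomial

section Heisenberg

variable {R : Type*} [CommRing R]

theorem heisenbergMk_mul (a b c a' b' c' : R) :
    heisenbergMk a b c * heisenbergMk a' b' c' =
      heisenbergMk (a + a') (b + b') (c + a * b' + c') := by
  apply Subtype.ext
  apply Subtype.ext
  change !![1, a, c; 0, 1, b; 0, 0, 1] * !![1, a', c'; 0, 1, b'; 0, 0, 1] =
    !![1, a + a', c + a * b' + c'; 0, 1, b + b'; 0, 0, 1]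
  ext i j
  fin_cases i <;> fin_cases j <;> simp [Matrix.mul_apply, Fin.sum_univ_three] <;> ring

theorem heisenbergMk_zero : heisenbergMk (0 : R) 0 0 = 1 :=
  Subtype.ext <| Subtype.ext Matrix.one_fin_three.symm

theorem heisenbergMk_pow (a b c : R) (n : ℕ) :
    heisenbergMk a b c ^ n = heisenbergMk (n * a) (n * b) (n * c + n.choose 2 * (a * b)) := by
  induction n with
  | zero => simp [heisenbergMk_zero]
  | succ n ih =>
    rw [pow_succ, ih, heisenbergMk_mul, Nat.choose_succ_succ' n 1]
    congr 1 <;> push_cast [Nat.choose_one_right] <;> ring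

theorem heisenbergMk_inj {a b c a' b' c' : R} :
    heisenbergMk a b c = heisenbergMk a' b' c' ↔ a = a' ∧ b = b' ∧ c = c' := by
  refine ⟨fun h => ?_, by rintro ⟨rfl, rfl, rfl⟩; rfl⟩
  have hentry : ∀ i j, !![1, a, c; 0, 1, b; 0, 0, 1] i j = !![1, a', c'; 0, 1, b'; 0, 0, 1] i j :=
    fun i j => congrArg (fun A : heisenberg R => (A : Matrix (Fin 3) (Fin 3) R) i j) h
  exact ⟨hentry 0 1, hentry 1 2, hentry 0 2⟩

theorem exists_heisenbergMk_eq (g : heisenberg R) : ∃ a b c, heisenbergMk a b c = g := by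
  obtain ⟨A, a, b, c, hA⟩ := g
  exact ⟨a, b, c, Subtype.ext (Subtype.ext hA.symm)⟩

theorem heisenberg_pow_eq_one_of_charP {p : ℕ} [hp : Fact p.Prime] [CharP R p] (hp2 : p ≠ 2)
    (g : heisenberg R) : g ^ p = 1 := by
  obtain ⟨a, b, c, rfl⟩ := exists_heisenbergMk_eq g
  have hchoose : (p.choose 2 : R) = 0 :=
    (CharP.cast_eq_zero_iff R p _).2 <|
      hp.out.dvd_choose_self two_ne_zero (lt_of_le_of_ne hp.out.two_le hp2.symm)
  simp only [heisenbergMk_pow, hchoose, CharP.cast_eq_zero, zero_mul, add_zero, heisenbergMk_zero]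

end Heisenberg

theorem natCast_fin_zmod_bijective (p : ℕ) [NeZero p] :
    Function.Bijective fun i : Fin p => ((i : ℕ) : ZMod p) := by
  refine ⟨fun i j h => Fin.ext ?_, fun x => ⟨⟨x.val, x.val_lt⟩, ZMod.natCast_zmod_val x⟩⟩
  exact ((ZMod.natCast_eq_natCast_iff _ _ _).1 h).eq_of_lt_of_lt i.2 j.2

theorem heisenberg_monomial_bijective (p : ℕ) [NeZero p] :
    Function.Bijective (monomial (heisenbergX (ZMod p)) (heisenbergY (ZMod p))
      (heisenbergZ (ZMod p)) : Fin p × Fin p × Fin p → heisenberg (ZMod p)) := by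
  have hmonomial : ∀ i j k : Fin p, monomial (heisenbergX (ZMod p)) (heisenbergY (ZMod p))
      (heisenbergZ (ZMod p)) (i, j, k) = heisenbergMk (j : ZMod p) i k := fun i j k => by
    simp [monomial, heisenbergX, heisenbergY, heisenbergZ, heisenbergMk_pow, heisenbergMk_mul]
  have hcast := natCast_fin_zmod_bijective p
  constructor
  · rintro ⟨i, j, k⟩ ⟨i', j', k'⟩ h
    rw [hmonomial, hmonomial] at h
    obtain ⟨hj, hi, hk⟩ := heisenbergMk_inj.1 h
    exact Prod.ext (hcast.1 hi) (Prod.ext (hcast.1 hj) (hcast.1 hk))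
  · intro g
    obtain ⟨a, b, c, rfl⟩ := exists_heisenbergMk_eq g
    obtain ⟨i, rfl⟩ := hcast.2 b
    obtain ⟨j, rfl⟩ := hcast.2 a
    obtain ⟨k, rfl⟩ := hcast.2 c
    exact ⟨(i, j, k), hmonomial i j k⟩

theorem zmodCube_pow_eq_one {p : ℕ} (g : ZModCube p) : g ^ p = 1 :=
  Multiplicative.toAdd.injective <| funext fun l => by simp

theorem zmodCube_monomial_bijective (p : ℕ) [NeZero p] :
    Function.Bijective (monomial (zmodCubeGen p 0) (zmodCubeGen p 1) (zmodCubeGen p 2) :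
      Fin p × Fin p × Fin p → ZModCube p) := by
  have hmonomial : ∀ i j k : Fin p, monomial (zmodCubeGen p 0) (zmodCubeGen p 1)
      (zmodCubeGen p 2) (i, j, k) = Multiplicative.ofAdd ![(i : ZMod p), j, k] := fun i j k => by
    simp only [monomial, zmodCubeGen, ← ofAdd_nsmul, ← ofAdd_add]
    congr 1
    ext l
    fin_cases l <;> simp
  have hcast := natCast_fin_zmod_bijective p
  constructor
  · rintro ⟨i, j, k⟩ ⟨i', j', k'⟩ h
    rw [hmonomial, hmonomial] at h
    have hentry := congrFun (Multiplicative.ofAdd.injective h)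
    exact Prod.ext (hcast.1 (hentry 0)) (Prod.ext (hcast.1 (hentry 1)) (hcast.1 (hentry 2)))
  · intro g
    obtain ⟨i, hi⟩ := hcast.2 (g.toAdd 0)
    obtain ⟨j, hj⟩ := hcast.2 (g.toAdd 1)
    obtain ⟨k, hk⟩ := hcast.2 (g.toAdd 2)
    refine ⟨(i, j, k), (hmonomial i j k).trans <| Multiplicative.toAdd.injective ?_⟩
    ext l
    fin_cases l
    exacts [hi, hj, hk]

theorem theorem3p1 (p : ℕ) [Fact p.Prime] (hp : p ≠ 2) :
    (∀ F : MonoidAlgebra ℤ (heisenberg (ZMod p)),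
      (∃! a : Fin p → Fin p → Fin p → ℤ, F = groupRingPoly
        (heisenbergX (ZMod p)) (heisenbergY (ZMod p)) (heisenbergZ (ZMod p)) a) ∧
      ∀ a : Fin p → Fin p → Fin p → ℤ, F = groupRingPoly
        (heisenbergX (ZMod p)) (heisenbergY (ZMod p)) (heisenbergZ (ZMod p)) a →
        groupDet F ≡ (∑ i : Fin p, ∑ j : Fin p, ∑ k : Fin p, a i j k) ^ (p ^ 3) [ZMOD (p : ℤ) ^ 3]) ∧
    (∀ F : MonoidAlgebra ℤ (ZModCube p),
      (∃! a : Fin p → Fin p → Fin p → ℤ, F = groupRingPoly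
        (zmodCubeGen p 0) (zmodCubeGen p 1) (zmodCubeGen p 2) a) ∧
      ∀ a : Fin p → Fin p → Fin p → ℤ, F = groupRingPoly
        (zmodCubeGen p 0) (zmodCubeGen p 1) (zmodCubeGen p 2) a →
        groupDet F ≡ (∑ i : Fin p, ∑ j : Fin p, ∑ k : Fin p, a i j k) ^ (p ^ 3) [ZMOD (p : ℤ) ^ 3]) :=
  ⟨theorem3p1_general (heisenberg_pow_eq_one_of_charP hp) (heisenberg_monomial_bijective p),
    theorem3p1_general zmodCube_pow_eq_one (zmodCube_monomial_bijective p)⟩
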